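/- For an entire function $f$ and $r>0$ write $M(r)=M(r,f)=\max_{|z|=r}|f(z)|$; an entire function is called transcendental if it is not a polynomial. The order and the lower order of a transcendental entire function $f$ are $$\rho(f)=\limsup_{r\to\infty}\frac{\log\log M(r)}{\log r},\qquad \lambda(f)=\liminf_{r\to\infty}\frac{\log\log M(r)}{\log r}.$$ A transcendental entire function $f$ is called strongly log-regular if, for every $\varepsilon\in(0,1)$, there exist $R>0$ and $k>1$ such that $$\log M(r^k)\ge (k\log M(r))^{1/\varepsilon}\qquad\text{for all } r>R.$$ There exists a transcendental entire function $f$ with $\lambda(f)=0$ and $0<\rho(f)<\infty$ which is strongly log-regular. -/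

import Mathlib

open Filter

/-- A transcendental entire function: holomorphic on the whole plane and not a polynomial. -/
def IsTranscendentalEntire (f : ℂ → ℂ) : Prop :=
  Differentiable ℂ f ∧ ¬ ∃ p : Polynomial ℂ, ∀ z : ℂ, f z = p.eval z

/-- The maximum modulus `M(r, f) = max_{|z| = r} |f z|`. For continuous `f` and `r ≥ 0` the
supremum is over a nonempty compact set of reals, so it is attained. -/
noncomputable def maxModulus (f : ℂ → ℂ) (r : ℝ) : ℝ :=
  sSup ((fun z : ℂ => ‖f z‖) '' Metric.sphere (0 : ℂ) r)

/-- The order `ρ(f) = limsup_{r → ∞} log log M(r) / log r`, an extended real. -/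
noncomputable def entireOrder (f : ℂ → ℂ) : EReal :=
  limsup (fun r : ℝ =>
    ((Real.log (Real.log (maxModulus f r)) / Real.log r : ℝ) : EReal)) atTop

/-- The lower order `λ(f) = liminf_{r → ∞} log log M(r) / log r`, an extended real. -/
noncomputable def entireLowerOrder (f : ℂ → ℂ) : EReal :=
  liminf (fun r : ℝ =>
    ((Real.log (Real.log (maxModulus f r)) / Real.log r : ℝ) : EReal)) atTop

/-- Strong log-regularity of `f`: for every `ε ∈ (0,1)` there are `R > 0` and `k > 1` with
`log M(r^k) ≥ (k log M(r))^{1/ε}` for all `r > R`. -/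
def IsStronglyLogRegular (f : ℂ → ℂ) : Prop :=
  IsTranscendentalEntire f ∧
    ∀ ε : ℝ, 0 < ε → ε < 1 → ∃ R k : ℝ, 0 < R ∧ 1 < k ∧ ∀ r : ℝ, R < r →
      (k * Real.log (maxModulus f r)) ^ (1 / ε) ≤ Real.log (maxModulus f (r ^ k))

/-! For a gauge s, take f(z) = ∑ exp(-2^j s(j)) z^(2^j). Up to an additive O(log t), log log M(e^t)
lies between constant multiples of the inverse of s at t (`two_pow_le_log_gaugeSeries`,
`log_gaugeSeries_le`). Order and lower order thus compare s with the identity: contact at (n!)²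
makes the order positive, s(x) ≥ x makes it finite, and unbounded s(x)/x makes the lower order zero.
The bound s(cx) ≤ c² s(x) still holds, so multiplying t by a large k multiplies log log M by about
√k at least; this is strong log-regularity. -/

open scoped Nat Topology

/-! ### The gauge -/

/-- A doubling gauge `s` with `x ≤ s x`, touching the identity at the squares `(n!)²` and
arbitrarily large relative to the identity in between. -/
noncomputable def facGauge (x : ℝ) : ℝ :=
  ⨅ n : ℕ, max ((n ! : ℝ) ^ 2) (x ^ 2 / (n ! : ℝ) ^ 2)

lemma factorial_sq_pos (n : ℕ) : (0 : ℝ) < (n ! : ℝ) ^ 2 := by positivity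

lemma bddBelow_range_gauge (x : ℝ) :
    BddBelow (Set.range fun n : ℕ => max ((n ! : ℝ) ^ 2) (x ^ 2 / (n ! : ℝ) ^ 2)) := by
  refine ⟨0, ?_⟩
  rintro _ ⟨n, rfl⟩
  exact le_max_of_le_left (by positivity)

lemma facGauge_le (x : ℝ) (n : ℕ) : facGauge x ≤ max ((n ! : ℝ) ^ 2) (x ^ 2 / (n ! : ℝ) ^ 2) :=
  ciInf_le (bddBelow_range_gauge x) n

lemma le_facGauge (x : ℝ) : x ≤ facGauge x := by
  refine le_ciInf fun n => ?_
  have h := factorial_sq_pos n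
  rcases le_total x ((n ! : ℝ) ^ 2) with hx | hx
  · exact le_max_of_le_left hx
  · refine le_max_of_le_right ?_
    rw [le_div_iff₀ h]
    nlinarith

lemma facGauge_mono {x y : ℝ} (hx : 0 ≤ x) (hxy : x ≤ y) : facGauge x ≤ facGauge y := by
  refine le_ciInf fun n => (facGauge_le x n).trans ?_
  gcongr

/-- Scaling the argument by c multiplies each competing maximum by at most c². -/
lemma facGauge_mul_le {c : ℝ} (hc : 1 ≤ c) (x : ℝ) : facGauge (c * x) ≤ c ^ 2 * facGauge x := by
  have hc2 : 1 ≤ c ^ 2 := one_le_pow₀ hc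
  have hc0 : 0 < c ^ 2 := by positivity
  rw [← div_le_iff₀' hc0]
  refine le_ciInf fun n => ?_
  rw [div_le_iff₀' hc0, mul_max_of_nonneg _ _ hc0.le]
  refine (facGauge_le _ n).trans (max_le_max ?_ (le_of_eq (by ring)))
  exact le_mul_of_one_le_left (by positivity) hc2

lemma facGauge_le_sq {x : ℝ} (hx : 1 ≤ x) : facGauge x ≤ x ^ 2 := by
  refine (facGauge_le x 0).trans ?_
  simpa using one_le_pow₀ hx (n := 2)

lemma facGauge_factorial_sq_le (n : ℕ) : facGauge ((n ! : ℝ) ^ 2) ≤ (n ! : ℝ) ^ 2 := by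
  refine (facGauge_le _ n).trans (max_le le_rfl (le_of_eq ?_))
  have h := factorial_sq_pos n
  field_simp

/-- The point n!(n+1)! is the geometric mean of consecutive contact points; there s(x)/x is at least
n + 1. -/
lemma le_facGauge_factorial_mul (n : ℕ) :
    ((n + 1)! : ℝ) ^ 2 ≤ facGauge ((n ! : ℝ) * ((n + 1)! : ℝ)) := by
  refine le_ciInf fun m => ?_
  rcases le_or_gt m n with h | h
  · refine le_max_of_le_right ?_
    rw [le_div_iff₀ (factorial_sq_pos m), mul_pow, mul_comm]
    gcongr
  · refine le_max_of_le_left ?_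
    gcongr
    exact h

/-! ### Growth of the positive series -/

/-- The series `∑ exp (2 ^ j * (t - s j))`, the value at `exp t` of the entire function below. -/
noncomputable def gaugeSeries (t : ℝ) : ℝ := ∑' j : ℕ, Real.exp (2 ^ j * (t - facGauge j))

lemma exp_neg_two_pow_le (j : ℕ) : Real.exp (-2 ^ j) ≤ (1 / 2 : ℝ) / 2 ^ j := by
  have h1 : ((j + 1 : ℕ) : ℝ) ≤ 2 ^ j := by exact_mod_cast Nat.lt_two_pow_self
  have h2 : (2 : ℝ) ≤ Real.exp 1 := by linarith [Real.add_one_le_exp (1 : ℝ)]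
  have h3 : (2 : ℝ) ^ (j + 1) ≤ Real.exp (2 ^ j) := by
    calc (2 : ℝ) ^ (j + 1) ≤ Real.exp 1 ^ (j + 1) := by gcongr
      _ = Real.exp ((j + 1 : ℕ) : ℝ) := by rw [← Real.exp_nat_mul, mul_one]
      _ ≤ _ := Real.exp_le_exp.2 h1
  rw [Real.exp_neg, div_div, ← pow_succ', one_div]
  exact inv_anti₀ (by positivity) h3

lemma facGauge_nonneg (j : ℕ) : 0 ≤ facGauge j := (Nat.cast_nonneg j).trans (le_facGauge j)

/-- The m head terms are bounded crudely; in the tail s(j) ≥ t + 1, so the exponent is at most -2^j.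
-/
lemma exp_gauge_term_le {t : ℝ} (ht : 0 ≤ t) {m : ℕ} (hm : t ≤ facGauge m - 1) (j : ℕ) :
    Real.exp (2 ^ j * (t - facGauge j)) ≤
      (if j ∈ Finset.range m then Real.exp (2 ^ m * t) else 0) + (1 / 2 : ℝ) / 2 ^ j := by
  by_cases h : j < m
  · rw [if_pos (Finset.mem_range.2 h)]
    refine le_add_of_le_of_nonneg (Real.exp_le_exp.2 ?_) (by positivity)
    calc (2 : ℝ) ^ j * (t - facGauge j) ≤ 2 ^ j * t := by gcongr; linarith [facGauge_nonneg j]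
      _ ≤ 2 ^ m * t := by gcongr; norm_num
  · rw [if_neg (by simpa using h), zero_add]
    refine le_trans (Real.exp_le_exp.2 ?_) (exp_neg_two_pow_le j)
    have : facGauge m ≤ facGauge j := facGauge_mono (by positivity) (by exact_mod_cast not_lt.1 h)
    have h2 : (0 : ℝ) < 2 ^ j := by positivity
    nlinarith

lemma summable_gauge_bound (t : ℝ) (m : ℕ) :
    Summable fun j : ℕ =>
      (if j ∈ Finset.range m then Real.exp (2 ^ m * t) else 0) + (1 / 2 : ℝ) / 2 ^ j :=
  (summable_of_ne_finset_zero (s := Finset.range m) fun _ h => if_neg h).add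
    (summable_geometric_two' (1 : ℝ))

lemma exists_le_gauge_sub_one (t : ℝ) : ∃ m : ℕ, t ≤ facGauge m - 1 := by
  obtain ⟨m, hm⟩ := exists_nat_ge (t + 1)
  exact ⟨m, by linarith [le_facGauge (m : ℝ)]⟩

lemma summable_gaugeSeries {t : ℝ} (ht : 0 ≤ t) :
    Summable fun j : ℕ => Real.exp (2 ^ j * (t - facGauge j)) := by
  obtain ⟨m, hm⟩ := exists_le_gauge_sub_one t
  exact (summable_gauge_bound t m).of_nonneg_of_le (fun _ => (Real.exp_pos _).le)
    (exp_gauge_term_le ht hm)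

lemma exp_le_gaugeSeries {t : ℝ} (ht : 0 ≤ t) (j : ℕ) :
    Real.exp (2 ^ j * (t - facGauge j)) ≤ gaugeSeries t :=
  (summable_gaugeSeries ht).le_tsum j fun _ _ => (Real.exp_pos _).le

lemma two_pow_le_log_gaugeSeries {t : ℝ} {j : ℕ} (h : facGauge j + 1 ≤ t) :
    2 ^ j ≤ Real.log (gaugeSeries t) := by
  have ht : 0 ≤ t := by linarith [facGauge_nonneg j]
  have h1 := exp_le_gaugeSeries ht j
  rw [Real.le_log_iff_exp_le ((Real.exp_pos _).trans_le h1)]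
  refine le_trans (Real.exp_le_exp.2 ?_) h1
  exact le_mul_of_one_le_right (by positivity) (by linarith)

lemma log_gaugeSeries_le {t : ℝ} (ht : 1 ≤ t) {m : ℕ} (hm : t ≤ facGauge m - 1) :
    Real.log (gaugeSeries t) ≤ 2 ^ (m + 1) * t := by
  have ht0 : 0 ≤ t := by linarith
  have hpos : 0 < gaugeSeries t := (Real.exp_pos _).trans_le (exp_le_gaugeSeries ht0 0)
  rw [Real.log_le_iff_le_exp hpos]
  have hs : Summable fun j : ℕ => (if j ∈ Finset.range m then Real.exp (2 ^ m * t) else 0) :=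
    summable_of_ne_finset_zero (s := Finset.range m) fun _ h => if_neg h
  have hg : Summable fun j : ℕ => (1 / 2 : ℝ) / 2 ^ j :=
    summable_geometric_two' (1 : ℝ)
  have h1 : (1 : ℝ) ≤ Real.exp (2 ^ m * t) := Real.one_le_exp (by positivity)
  have h2 : (m : ℝ) ≤ 2 ^ m * t := by
    have : (m : ℝ) ≤ 2 ^ m := by exact_mod_cast Nat.lt_two_pow_self.le
    exact this.trans (le_mul_of_one_le_right (by positivity) ht)
  calc gaugeSeries t ≤ ∑' j : ℕ,
        ((if j ∈ Finset.range m then Real.exp (2 ^ m * t) else 0) + (1 / 2 : ℝ) / 2 ^ j) :=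
        (summable_gaugeSeries ht0).tsum_le_tsum (exp_gauge_term_le ht0 hm)
          (summable_gauge_bound t m)
    _ = m * Real.exp (2 ^ m * t) + 1 := by
        rw [hs.tsum_add hg, tsum_geometric_two', tsum_eq_sum (s := Finset.range m)
          (fun _ h => if_neg h), Finset.sum_congr rfl fun _ h => if_pos h]
        simp
    _ ≤ (m + 1) * Real.exp (2 ^ m * t) := by linarith
    _ ≤ Real.exp m * Real.exp (2 ^ m * t) := by gcongr; exact Real.add_one_le_exp _
    _ = Real.exp (m + 2 ^ m * t) := (Real.exp_add _ _).symm
    _ ≤ _ := Real.exp_le_exp.2 (by rw [pow_succ]; linarith)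

/-! ### The entire function and its maximum modulus -/

/-- The lacunary entire function `∑ exp (-2 ^ j * s j) z ^ (2 ^ j)`. -/
noncomputable def gaugeEntire (z : ℂ) : ℂ :=
  ∑' j : ℕ, (Real.exp (-(2 ^ j * facGauge j)) : ℂ) * z ^ 2 ^ j

lemma exp_mul_exp_pow (t : ℝ) (j : ℕ) :
    Real.exp (-(2 ^ j * facGauge j)) * Real.exp t ^ 2 ^ j = Real.exp (2 ^ j * (t - facGauge j)) := by
  rw [← Real.exp_nat_mul, ← Real.exp_add]
  push_cast
  ring_nf

lemma norm_gaugeEntire_term_le {z : ℂ} {t : ℝ} (hz : ‖z‖ ≤ Real.exp t) (j : ℕ) :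
    ‖(Real.exp (-(2 ^ j * facGauge j)) : ℂ) * z ^ 2 ^ j‖ ≤ Real.exp (2 ^ j * (t - facGauge j)) := by
  rw [← exp_mul_exp_pow, norm_mul, norm_pow, Complex.norm_real, Real.norm_of_nonneg
    (Real.exp_pos _).le]
  gcongr

lemma gaugeEntire_exp (t : ℝ) : gaugeEntire (Real.exp t : ℂ) = (gaugeSeries t : ℂ) := by
  rw [gaugeEntire, gaugeSeries, Complex.ofReal_tsum]
  refine tsum_congr fun j => ?_
  rw [← exp_mul_exp_pow]
  push_cast
  rfl

lemma norm_gaugeEntire_le {z : ℂ} {t : ℝ} (ht : 0 ≤ t) (hz : ‖z‖ ≤ Real.exp t) :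
    ‖gaugeEntire z‖ ≤ gaugeSeries t :=
  tsum_of_norm_bounded (summable_gaugeSeries ht).hasSum (norm_gaugeEntire_term_le hz)

lemma gaugeSeries_nonneg (t : ℝ) : 0 ≤ gaugeSeries t := tsum_nonneg fun _ => (Real.exp_pos _).le

/-- The coefficients are positive, so the maximum is attained on the positive axis. -/
lemma maxModulus_gaugeEntire {t : ℝ} (ht : 0 ≤ t) :
    maxModulus gaugeEntire (Real.exp t) = gaugeSeries t := by
  refine IsGreatest.csSup_eq ⟨⟨(Real.exp t : ℂ), ?_, ?_⟩, ?_⟩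
  · rw [mem_sphere_zero_iff_norm, Complex.norm_real, Real.norm_of_nonneg (Real.exp_pos _).le]
  · simp only [gaugeEntire_exp, Complex.norm_real, Real.norm_of_nonneg (gaugeSeries_nonneg t)]
  · rintro _ ⟨z, hz, rfl⟩
    exact norm_gaugeEntire_le ht (mem_sphere_zero_iff_norm.1 hz).le

lemma differentiable_gaugeEntire : Differentiable ℂ gaugeEntire := by
  intro z
  have hz : ‖z‖ < Real.exp ‖z‖ := by linarith [Real.add_one_le_exp ‖z‖]
  have hd : DifferentiableOn ℂ gaugeEntire (Metric.ball 0 (Real.exp ‖z‖)) := by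
    refine Complex.differentiableOn_tsum_of_summable_norm
      (summable_gaugeSeries (norm_nonneg z)) (fun j => ?_) Metric.isOpen_ball fun j w hw => ?_
    · fun_prop
    · exact norm_gaugeEntire_term_le (mem_ball_zero_iff.1 hw).le j
  exact hd.differentiableAt (Metric.isOpen_ball.mem_nhds (mem_ball_zero_iff.2 hz))

lemma Polynomial.exists_norm_eval_le_mul_pow (p : Polynomial ℂ) :
    ∃ C : ℝ, ∀ z : ℂ, 1 ≤ ‖z‖ → ‖p.eval z‖ ≤ C * ‖z‖ ^ p.natDegree := by
  refine ⟨∑ i ∈ Finset.range (p.natDegree + 1), ‖p.coeff i‖, fun z hz => ?_⟩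
  rw [Polynomial.eval_eq_sum_range, Finset.sum_mul]
  refine (norm_sum_le _ _).trans (Finset.sum_le_sum fun i hi => ?_)
  rw [norm_mul, norm_pow]
  gcongr
  exact Nat.lt_succ_iff.1 (Finset.mem_range.1 hi)

lemma isTranscendentalEntire_gaugeEntire : IsTranscendentalEntire gaugeEntire := by
  refine ⟨differentiable_gaugeEntire, ?_⟩
  rintro ⟨p, hp⟩
  obtain ⟨C, hC⟩ := p.exists_norm_eval_le_mul_pow
  set d := p.natDegree
  have hd : (d : ℝ) + 1 ≤ 2 ^ d := by exact_mod_cast Nat.lt_two_pow_self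
  -- Since 2^d ≥ d + 1, the term of degree 2^d beats r^d by a factor of at least exp(t - 2^d s(d)) ≥
  -- exp C > C.
  set t : ℝ := max 0 (2 ^ d * facGauge d + C)
  have ht : 0 ≤ t := le_max_left _ _
  have ht' : 2 ^ d * facGauge d + C ≤ t := le_max_right _ _
  have hn : ‖(Real.exp t : ℂ)‖ = Real.exp t := by
    rw [Complex.norm_real, Real.norm_of_nonneg (Real.exp_pos _).le]
  have h1 := hC (Real.exp t : ℂ) (by rw [hn]; exact Real.one_le_exp ht)
  rw [← hp, gaugeEntire_exp, hn, Complex.norm_real, Real.norm_of_nonneg (gaugeSeries_nonneg t)]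
    at h1
  have h2 := (exp_le_gaugeSeries ht d).trans h1
  have h3 : C < Real.exp C := by linarith [Real.add_one_le_exp C]
  have h4 : Real.exp C * Real.exp t ^ d ≤ Real.exp (2 ^ d * (t - facGauge d)) := by
    rw [← Real.exp_nat_mul, ← Real.exp_add]
    refine Real.exp_le_exp.2 ?_
    nlinarith
  have h5 : C * Real.exp t ^ d < Real.exp C * Real.exp t ^ d := by gcongr
  linarith

lemma log_maxModulus_gaugeEntire_exp {t : ℝ} (ht : 0 ≤ t) :
    Real.log (maxModulus gaugeEntire (Real.exp t)) = Real.log (gaugeSeries t) := by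
  rw [maxModulus_gaugeEntire ht]

/-! ### Strong log-regularity -/

lemma isStronglyLogRegular_gaugeEntire : IsStronglyLogRegular gaugeEntire := by
  refine ⟨isTranscendentalEntire_gaugeEntire, fun ε hε0 hε1 => ?_⟩
  obtain ⟨C, hC⟩ := exists_nat_ge (5 * (1 / ε))
  have hε : 1 < 1 / ε := (one_lt_div hε0).2 hε1
  have hC1 : (1 : ℝ) ≤ C := by linarith
  -- Chosen so that 4C²(t + 1) + 1 ≤ kt for t ≥ 1.
  set k : ℝ := 9 * C ^ 2 with hk
  have hk9 : 9 ≤ k := by nlinarith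
  -- The k² forces k² < s(m) ≤ m², hence k ≤ m below; the s(0) excludes m = 0.
  refine ⟨Real.exp (k ^ 2 + facGauge 0), k, Real.exp_pos _, by linarith, fun r hr => ?_⟩
  obtain ⟨t, rfl⟩ : ∃ t, r = Real.exp t :=
    ⟨Real.log r, (Real.exp_log ((Real.exp_pos _).trans hr)).symm⟩
  rw [Real.exp_lt_exp] at hr
  have hg0 : 0 ≤ facGauge 0 := by simpa using facGauge_nonneg 0
  have ht1 : 1 ≤ t := by nlinarith
  rw [← Real.exp_mul, mul_comm t k, log_maxModulus_gaugeEntire_exp (by linarith),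
    log_maxModulus_gaugeEntire_exp (by nlinarith)]
  classical
  have hex := exists_le_gauge_sub_one t
  -- The least such m acts as the inverse of s at t: s(m-1) < t + 1 ≤ s(m).
  obtain ⟨m, hm, hmin⟩ : ∃ m : ℕ, t ≤ facGauge m - 1 ∧ ∀ i < m, ¬ t ≤ facGauge i - 1 :=
    ⟨Nat.find hex, Nat.find_spec hex, fun i hi => Nat.find_min hex hi⟩
  have hm0 : m ≠ 0 := by
    rintro rfl
    rw [Nat.cast_zero] at hm
    nlinarith
  have hm1 : (1 : ℝ) ≤ m := by exact_mod_cast Nat.one_le_iff_ne_zero.2 hm0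
  have hmsq := facGauge_le_sq hm1
  have hkm : k ≤ m := by
    refine (sq_le_sq₀ (by positivity) (by positivity)).1 ?_
    linarith
  have hpred : facGauge ((m : ℝ) - 1) < t + 1 := by
    have := hmin (m - 1) (by omega)
    rw [Nat.cast_sub (by omega), Nat.cast_one] at this
    linarith
  -- Here Cm ≤ 2C(m-1), so doubling transfers the bound at m - 1.
  have hCm : facGauge ((C * m : ℕ) : ℝ) + 1 ≤ k * t := by
    have h1 : facGauge ((C * m : ℕ) : ℝ) ≤ facGauge ((2 * C) * ((m : ℝ) - 1)) := by
      refine facGauge_mono (by positivity) ?_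
      push_cast
      nlinarith
    have h2 := facGauge_mul_le (c := 2 * C) (by linarith) ((m : ℝ) - 1)
    have h3 : (2 * (C : ℝ)) ^ 2 * facGauge ((m : ℝ) - 1) ≤ (2 * (C : ℝ)) ^ 2 * (t + 1) := by
      gcongr
    have h4 : (1 : ℝ) ≤ C ^ 2 := one_le_pow₀ hC1
    nlinarith
  have hup := log_gaugeSeries_le ht1 hm
  have hlow := two_pow_le_log_gaugeSeries hCm
  have hφ0 : 0 ≤ Real.log (gaugeSeries t) := by
    have h0 : facGauge ((0 : ℕ) : ℝ) + 1 ≤ t := by rw [Nat.cast_zero]; nlinarith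
    exact le_trans (by positivity) (two_pow_le_log_gaugeSeries h0)
  have hm2 : (m : ℝ) ≤ 2 ^ m := by exact_mod_cast Nat.lt_two_pow_self.le
  -- From k ≤ m ≤ 2^m and t ≤ m² ≤ 2^(2m); C ≥ 5/ε then absorbs the 5 and the power 1/ε.
  have hbase : k * Real.log (gaugeSeries t) ≤ 2 ^ (5 * m : ℝ) := by
    calc k * Real.log (gaugeSeries t) ≤ 2 ^ m * (2 ^ (m + 1) * ((2 ^ m) ^ 2)) := by
          refine mul_le_mul (hkm.trans hm2) (hup.trans ?_) hφ0 (by positivity)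
          gcongr
          have : (m : ℝ) ^ 2 ≤ (2 ^ m) ^ 2 := by gcongr
          linarith
      _ = 2 ^ (4 * m + 1) := by ring
      _ ≤ 2 ^ (5 * m) := pow_le_pow_right₀ (by norm_num) (by omega)
      _ = 2 ^ (5 * m : ℝ) := by rw [← Real.rpow_natCast]; push_cast; rfl
  calc (k * Real.log (gaugeSeries t)) ^ (1 / ε) ≤ ((2 : ℝ) ^ (5 * m : ℝ)) ^ (1 / ε) := by
        gcongr
    _ = 2 ^ (5 * m * (1 / ε) : ℝ) := by rw [← Real.rpow_mul (by norm_num)]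
    _ ≤ 2 ^ ((C * m : ℕ) : ℝ) := by
        refine Real.rpow_le_rpow_of_exponent_le (by norm_num) ?_
        push_cast
        nlinarith
    _ = 2 ^ (C * m) := Real.rpow_natCast _ _
    _ ≤ _ := hlow

/-! ### Order and lower order -/

/-- The quotient whose upper and lower limits are the order and the lower order. -/
noncomputable def orderQuotient (r : ℝ) : ℝ :=
  Real.log (Real.log (maxModulus gaugeEntire r)) / Real.log r

lemma orderQuotient_exp {t : ℝ} (ht : 0 ≤ t) :
    orderQuotient (Real.exp t) = Real.log (Real.log (gaugeSeries t)) / t := by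
  rw [orderQuotient, log_maxModulus_gaugeEntire_exp ht, Real.log_exp]

lemma one_le_log_gaugeSeries {t : ℝ} (ht : 2 ≤ t) : 1 ≤ Real.log (gaugeSeries t) := by
  have h0 : facGauge ((0 : ℕ) : ℝ) ≤ 1 := by simpa using facGauge_le 0 0
  simpa using two_pow_le_log_gaugeSeries (j := 0) (t := t) (by linarith)

lemma log_log_gaugeSeries_le {t : ℝ} (ht : 2 ≤ t) {m : ℕ} (hm : t ≤ facGauge m - 1) :
    Real.log (Real.log (gaugeSeries t)) ≤ m + 1 + Real.log t := by
  have h1 := one_le_log_gaugeSeries ht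
  have h2 : Real.log 2 ≤ 1 := by linarith [Real.log_le_sub_one_of_pos (show (0 : ℝ) < 2 by norm_num)]
  calc Real.log (Real.log (gaugeSeries t)) ≤ Real.log (2 ^ (m + 1) * t) :=
        Real.log_le_log (by linarith) (log_gaugeSeries_le (by linarith) hm)
    _ = (m + 1) * Real.log 2 + Real.log t := by
        rw [Real.log_mul (by positivity) (by positivity), Real.log_pow]
        push_cast
        rfl
    _ ≤ (m + 1) * 1 + Real.log t := by gcongr
    _ = _ := by ring

lemma orderQuotient_nonneg {r : ℝ} (hr : Real.exp 2 ≤ r) : 0 ≤ orderQuotient r := by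
  have h0 : 0 < r := (Real.exp_pos _).trans_le hr
  have ht : 2 ≤ Real.log r := (Real.le_log_iff_exp_le h0).2 hr
  rw [← Real.exp_log h0, orderQuotient_exp (by linarith)]
  exact div_nonneg (Real.log_nonneg (one_le_log_gaugeSeries ht)) (by linarith)

lemma orderQuotient_le_four {r : ℝ} (hr : Real.exp 2 ≤ r) : orderQuotient r ≤ 4 := by
  have h0 : 0 < r := (Real.exp_pos _).trans_le hr
  have ht : 2 ≤ Real.log r := (Real.le_log_iff_exp_le h0).2 hr
  rw [← Real.exp_log h0, orderQuotient_exp (by linarith)]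
  set t := Real.log r
  rw [div_le_iff₀ (by linarith)]
  have h1 := Nat.le_ceil (t + 1)
  have h2 := Nat.ceil_lt_add_one (a := t + 1) (by linarith)
  -- This index is admissible because s(x) ≥ x.
  have h3 := log_log_gaugeSeries_le ht (m := ⌈t + 1⌉₊)
    (by linarith [le_facGauge (⌈t + 1⌉₊ : ℝ)])
  linarith [Real.log_le_sub_one_of_pos (show 0 < t by linarith)]

lemma tendsto_factorial_sq : Tendsto (fun n : ℕ => (n ! : ℝ) ^ 2) atTop atTop := by
  refine tendsto_atTop_mono (fun n => ?_) tendsto_natCast_atTop_atTop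
  have h1 : (n : ℝ) ≤ n ! := by exact_mod_cast Nat.self_le_factorial n
  have h2 : (1 : ℝ) ≤ n ! := by exact_mod_cast Nat.factorial_pos n
  nlinarith

lemma le_orderQuotient_factorial_sq (n : ℕ) :
    Real.log 2 / 2 ≤ orderQuotient (Real.exp ((n ! : ℝ) ^ 2 + 1)) := by
  have hp := factorial_sq_pos n
  have h1 : (1 : ℝ) ≤ (n ! : ℝ) ^ 2 := by
    exact_mod_cast Nat.one_le_pow _ _ (Nat.factorial_pos n)
  -- The index is a contact point, j = s(j) = t - 1.
  have h2 := two_pow_le_log_gaugeSeries (t := (n ! : ℝ) ^ 2 + 1) (j := n ! ^ 2)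
    (by push_cast; linarith [facGauge_factorial_sq_le n])
  have h3 := Real.log_le_log (by positivity) h2
  rw [Real.log_pow] at h3
  push_cast at h3
  have h4 : 0 < Real.log 2 := Real.log_pos (by norm_num)
  rw [orderQuotient_exp (by linarith), le_div_iff₀ (by linarith)]
  nlinarith

/-- With t = ((n+1)!)² - 1, the index m = n!(n+1)! already satisfies t ≤ s(m) - 1, while m/(t + 1) =
1/(n+1). -/
lemma tendsto_orderQuotient_factorial :
    Tendsto (fun n : ℕ => orderQuotient (Real.exp (((n + 1)! : ℝ) ^ 2 - 1))) atTop (𝓝 0) := by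
  have hT : Tendsto (fun n : ℕ => ((n + 1)! : ℝ) ^ 2 - 1) atTop atTop :=
    tendsto_atTop_add_const_right _ _ ((tendsto_add_atTop_iff_nat 1).2 tendsto_factorial_sq)
  have hlog : Tendsto (fun n : ℕ => Real.log (((n + 1)! : ℝ) ^ 2 - 1) / (((n + 1)! : ℝ) ^ 2 - 1))
      atTop (𝓝 0) := Real.isLittleO_log_id_atTop.tendsto_div_nhds_zero.comp hT
  have hinv : Tendsto (fun n : ℕ => 4 * (1 / ((n : ℝ) + 1))) atTop (𝓝 0) := by
    simpa using tendsto_one_div_add_atTop_nhds_zero_nat.const_mul (4 : ℝ)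
  have hsum := hinv.add hlog
  rw [add_zero] at hsum
  refine squeeze_zero' ?_ ?_ hsum
  · filter_upwards [hT.eventually_ge_atTop 2] with n hn
    exact orderQuotient_nonneg (Real.exp_le_exp.2 hn)
  · filter_upwards [hT.eventually_ge_atTop 2] with n hn
    have ht : 0 < ((n + 1)! : ℝ) ^ 2 - 1 := by linarith
    have h1 := log_log_gaugeSeries_le hn (m := n ! * (n + 1)!)
      (by push_cast; linarith [le_facGauge_factorial_mul n])
    rw [orderQuotient_exp ht.le, ← sub_le_iff_le_add, ← sub_div, div_le_iff₀ ht]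
    have hfac : ((n + 1)! : ℝ) = (n + 1) * n ! := by
      rw [Nat.factorial_succ]
      push_cast
      rfl
    have hn1 : (0 : ℝ) < (n : ℝ) + 1 := by positivity
    have hf1 : (1 : ℝ) ≤ n ! := by exact_mod_cast Nat.factorial_pos n
    have hprod : (n ! : ℝ) * (n + 1)! = 1 / ((n : ℝ) + 1) * ((n + 1)! : ℝ) ^ 2 := by
      rw [hfac]
      field_simp
    have h2 : (1 : ℝ) ≤ n ! * (n + 1)! := by
      exact_mod_cast Nat.mul_pos (Nat.factorial_pos n) (Nat.factorial_pos (n + 1))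
    have h3 : 0 < 1 / ((n : ℝ) + 1) := by positivity
    push_cast at h1
    calc _ ≤ (n ! : ℝ) * (n + 1)! + 1 := by linarith
      _ ≤ 2 * ((n ! : ℝ) * (n + 1)!) := by linarith
      _ = 1 / ((n : ℝ) + 1) * (2 * ((n + 1)! : ℝ) ^ 2) := by rw [hprod]; ring
      _ ≤ 1 / ((n : ℝ) + 1) * (4 * (((n + 1)! : ℝ) ^ 2 - 1)) :=
          mul_le_mul_of_nonneg_left (by linarith) h3.le
      _ = _ := by ring

lemma entireLowerOrder_gaugeEntire : entireLowerOrder gaugeEntire = 0 := by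
  apply le_antisymm
  · have hT : Tendsto (fun n : ℕ => Real.exp (((n + 1)! : ℝ) ^ 2 - 1)) atTop atTop :=
      Real.tendsto_exp_atTop.comp (tendsto_atTop_add_const_right _ _
        ((tendsto_add_atTop_iff_nat 1).2 tendsto_factorial_sq))
    have hlim : Tendsto (fun n : ℕ =>
        ((orderQuotient (Real.exp (((n + 1)! : ℝ) ^ 2 - 1)) : ℝ) : EReal)) atTop (𝓝 0) :=
      (continuous_coe_real_ereal.tendsto 0).comp tendsto_orderQuotient_factorial
    rw [← hlim.liminf_eq]
    exact (liminf_le_liminf_of_le hT (u := fun r => ((orderQuotient r : ℝ) : EReal)))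
  · refine le_liminf_of_le (by isBoundedDefault) ?_
    filter_upwards [eventually_ge_atTop (Real.exp 2)] with r hr
    exact_mod_cast orderQuotient_nonneg hr

lemma entireOrder_gaugeEntire_pos : 0 < entireOrder gaugeEntire := by
  have hT : Tendsto (fun n : ℕ => Real.exp ((n ! : ℝ) ^ 2 + 1)) atTop atTop :=
    Real.tendsto_exp_atTop.comp (tendsto_atTop_add_const_right _ _ tendsto_factorial_sq)
  have hpos : (0 : EReal) < ((Real.log 2 / 2 : ℝ) : EReal) := by
    exact_mod_cast half_pos (Real.log_pos (by norm_num : (1 : ℝ) < 2))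
  refine hpos.trans_le (le_limsup_of_frequently_le ?_ (by isBoundedDefault))
  exact hT.frequently (Frequently.of_forall fun n =>
    EReal.coe_le_coe_iff.2 (le_orderQuotient_factorial_sq n))

lemma entireOrder_gaugeEntire_lt_top : entireOrder gaugeEntire < ⊤ := by
  refine lt_of_le_of_lt (b := ((4 : ℝ) : EReal)) ?_ (EReal.coe_lt_top 4)
  refine limsup_le_of_le (by isBoundedDefault) ?_
  filter_upwards [eventually_ge_atTop (Real.exp 2)] with r hr
  exact EReal.coe_le_coe_iff.2 (orderQuotient_le_four hr)

theorem mainTheorem7 :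
    ∃ f : ℂ → ℂ, IsTranscendentalEntire f ∧
      entireLowerOrder f = 0 ∧
      0 < entireOrder f ∧ entireOrder f < ⊤ ∧
      IsStronglyLogRegular f :=
  ⟨gaugeEntire, isTranscendentalEntire_gaugeEntire, entireLowerOrder_gaugeEntire,
    entireOrder_gaugeEntire_pos, entireOrder_gaugeEntire_lt_top,
    isStronglyLogRegular_gaugeEntire⟩
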